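/- Fix $p\in[\tfrac12,1)$. Let $(S_n)_{n\ge 0}$ be a simple random walk on $\mathbb{Z}$ with $S_0=0$ almost surely and mutually independent increments $X_n=S_n-S_{n-1}$, $n\ge 1$, satisfying $\mathrm{P}[X_n=+1]=p$ and $\mathrm{P}[X_n=-1]=1-p$. Let $R_n=\#\{1\le k\le n: X_k=+1\}$ and, for every positive integer $d$, let $N_d=\inf\{n\ge 0: S_n=d\}$. Then, for every positive integer $d$, $N_d$ is almost surely finite, $R_{N_d}/N_d$ is square-integrable, and $$\mathrm{E}\Big[\frac{R_{N_d}}{N_d}\Big]>\mathrm{E}\Big[\frac{R_{N_{d+1}}}{N_{d+1}}\Big];$$ moreover, $$\lim_{d\to\infty}\mathrm{E}\Big[\frac{R_{N_d}}{N_d}\Big]=p\qquad\text{and}\qquad\lim_{d\to\infty}\mathrm{Var}\Big[\frac{R_{N_d}}{N_d}\Big]=0.$$ -/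

import Mathlib

open MeasureTheory ProbabilityTheory Filter Topology

noncomputable section

namespace WalkWinRate

/-- The increment `X_{k+1} = S_{k+1} - S_k` of an integer-valued process; the increments
`X_1, X_2, …` are thus `increment S 0, increment S 1, …`. -/
def increment {Ω : Type*} (S : ℕ → Ω → ℤ) (k : ℕ) (ω : Ω) : ℤ :=
  S (k + 1) ω - S k ω

/-- `S` is a simple random walk on `ℤ` started at `0`, with mutually independent increments equal
to `+1` with probability `p` and to `-1` with probability `1 - p`. -/
structure IsSimpleRandomWalk {Ω : Type*} [MeasurableSpace Ω] (μ : Measure Ω) (p : ℝ)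
    (S : ℕ → Ω → ℤ) : Prop where
  measurable : ∀ n, Measurable (S n)
  start : ∀ᵐ ω ∂μ, S 0 ω = 0
  indep : iIndepFun (increment S) μ
  prob_up : ∀ k, μ.real {ω | increment S k ω = 1} = p
  prob_down : ∀ k, μ.real {ω | increment S k ω = -1} = 1 - p

/-- The number of wins up to time `n`: `R_n = #{1 ≤ j ≤ n : X_j = +1}` (with `j = k + 1`). -/
def wins {Ω : Type*} (S : ℕ → Ω → ℤ) (n : ℕ) (ω : Ω) : ℕ :=
  ((Finset.range n).filter (fun k => increment S k ω = 1)).card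

/-- The hitting time `N_d = inf {n ≥ 0 : S_n = d}`, equal to `⊤` if `d` is never reached. -/
def hitTime {Ω : Type*} (S : ℕ → Ω → ℤ) (d : ℕ) : Ω → WithTop ℕ :=
  hittingAfter S {(d : ℤ)} 0

/-- The win rate `R_{N_d} / N_d` (with value `0` where `N_d = ⊤`). -/
def winRate {Ω : Type*} (S : ℕ → Ω → ℤ) (d : ℕ) (ω : Ω) : ℝ :=
  (wins S ((hitTime S d ω).untopD 0) ω : ℝ) / (((hitTime S d ω).untopD 0 : ℕ) : ℝ)

end WalkWinRate

end

/-! At time `N_d` wins minus losses equal `d`, so the win rate is `1/2 + d / (2 N_d)` and its mean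
requires only `E[1/N_d]`. For `t` in `(0,1)` put `s = invGen p t = t / (p + (1 - p) t²)`. Then `s ^
n * t ^ (-S_n)` is a martingale; stopping it at `N_d` gives `E[s ^ N_d; N_d < ∞] = t ^ d`
(`integral_pow_hitTime`), and `t → 1` gives `N_d < ∞` almost surely. Since `invGen p` maps `0` to
`0` and `1` to `1`, `1/n` is the integral over `[0,1]` of `invGen ^ (n - 1) * invGen'`. By Fubini
`E[d / N_d]` is the integral of `ratio p` against the density `d * t ^ (d - 1)`
(`integral_inv_hitTime`). These densities move to the right as `d` grows and `ratio p` strictly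
decreases, hence the strict monotonicity (`integral_mul_ratio_strictAnti`). Both limits come from
the strong law along `N_d ≥ d` and bounded convergence (`tendsto_integral_winRate_pow`). -/

namespace WalkWinRate

/-! ### Deterministic paths and their stopped exponential weights. -/

/-- The position after `n` steps of the walk with steps `x 0, x 1, …`. -/
def partialSum (x : ℕ → ℤ) (n : ℕ) : ℤ := ∑ k ∈ Finset.range n, x k

/-- The path has not visited `d` up to time `n`. -/
def Avoids (d : ℤ) (x : ℕ → ℤ) (n : ℕ) : Prop := ∀ k ≤ n, partialSum x k ≠ d

/-- The factor `s * t ^ (-x)` attached to a step `x = ±1`. -/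
noncomputable def stepWeight (s t : ℝ) (x : ℤ) : ℝ :=
  if x = 1 then s / t else if x = -1 then s * t else 0

/-- The exponential weight of the first `n` steps. -/
noncomputable def weight (s t : ℝ) (x : ℕ → ℤ) (n : ℕ) : ℝ :=
  ∏ k ∈ Finset.range n, stepWeight s t (x k)

open scoped Classical in
/-- The exponential weight multiplied by the indicator of not having visited `d`. -/
noncomputable def avoidingWeight (s t : ℝ) (d : ℤ) (x : ℕ → ℤ) (n : ℕ) : ℝ :=
  if Avoids d x n then weight s t x n else 0

/-- The exponential weight stopped at the first visit to `d`. -/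
noncomputable def stoppedWeight (s t : ℝ) (d : ℤ) (x : ℕ → ℤ) : ℕ → ℝ
  | 0 => 1
  | n + 1 => stoppedWeight s t d x n + avoidingWeight s t d x n * (stepWeight s t (x n) - 1)

/-- All steps are `±1`. -/
def IsUnitPath (x : ℕ → ℤ) : Prop := ∀ k, x k = 1 ∨ x k = -1

lemma partialSum_succ (x : ℕ → ℤ) (n : ℕ) : partialSum x (n + 1) = partialSum x n + x n := by
  simp [partialSum, Finset.sum_range_succ]

lemma Avoids.mono {d : ℤ} {x : ℕ → ℤ} {m n : ℕ} (h : Avoids d x n) (hmn : m ≤ n) :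
    Avoids d x m := fun k hk => h k (hk.trans hmn)

lemma partialSum_congr {x y : ℕ → ℤ} {n : ℕ} (h : ∀ k < n, x k = y k) {m : ℕ} (hm : m ≤ n) :
    partialSum x m = partialSum y m :=
  Finset.sum_congr rfl fun k hk => h k ((Finset.mem_range.1 hk).trans_le hm)

/-- Only the first `n` steps matter, which is the source of the independence from step `n`. -/
lemma avoidingWeight_congr (s t : ℝ) (d : ℤ) {x y : ℕ → ℤ} {n : ℕ} (h : ∀ k < n, x k = y k) :
    avoidingWeight s t d x n = avoidingWeight s t d y n := by
  have h1 : Avoids d x n ↔ Avoids d y n :=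
    forall₂_congr fun k hk => by rw [partialSum_congr h hk]
  have h2 : weight s t x n = weight s t y n :=
    Finset.prod_congr rfl fun k hk => by rw [h k (Finset.mem_range.1 hk)]
  unfold avoidingWeight
  split_ifs <;> tauto

lemma weight_eq {s t : ℝ} (ht : t ≠ 0) {x : ℕ → ℤ} (hx : IsUnitPath x) (n : ℕ) :
    weight s t x n = s ^ n * t ^ (-partialSum x n) := by
  induction n with
  | zero => simp [weight, partialSum]
  | succ n ih =>
    have h1 : weight s t x (n + 1) = weight s t x n * stepWeight s t (x n) := by
      simp [weight, Finset.prod_range_succ]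
    rw [h1, ih, partialSum_succ, neg_add, zpow_add₀ ht, pow_succ]
    rcases hx n with h | h <;> simp [h, stepWeight] <;> field_simp

lemma abs_stepWeight_le {s t : ℝ} (hs : 0 ≤ s) (ht : 0 < t) (x : ℤ) :
    |stepWeight s t x| ≤ s / t + s * t := by
  have h1 : 0 ≤ s / t := by positivity
  have h2 : 0 ≤ s * t := by positivity
  unfold stepWeight
  split_ifs
  · rw [abs_of_nonneg h1]; linarith
  · rw [abs_of_nonneg h2]; linarith
  · simp; linarith

lemma abs_avoidingWeight_le {s t : ℝ} (hs : 0 ≤ s) (ht : 0 < t) (d : ℤ) (x : ℕ → ℤ) (n : ℕ) :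
    |avoidingWeight s t d x n| ≤ (s / t + s * t) ^ n := by
  unfold avoidingWeight
  split_ifs
  · rw [weight, Finset.abs_prod]
    calc _ ≤ ∏ _k ∈ Finset.range n, (s / t + s * t) :=
          Finset.prod_le_prod (fun _ _ => abs_nonneg _) fun _ _ => abs_stepWeight_le hs ht _
      _ = _ := by simp
  · simp; positivity

/-- Unit steps cannot jump over `d`. -/
lemma partialSum_lt {d : ℤ} (hd : 0 < d) {x : ℕ → ℤ} (hx : IsUnitPath x) {n : ℕ}
    (h : Avoids d x n) : partialSum x n < d := by
  induction n with
  | zero => simpa [partialSum] using hd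
  | succ n ih =>
    have h1 := ih (h.mono n.le_succ)
    have h2 := h (n + 1) le_rfl
    rw [partialSum_succ] at h2 ⊢
    rcases hx n with h3 | h3 <;> rw [h3] at h2 ⊢ <;> omega

lemma partialSum_le {x : ℕ → ℤ} (hx : IsUnitPath x) (n : ℕ) : partialSum x n ≤ n := by
  induction n with
  | zero => simp [partialSum]
  | succ n ih =>
    rw [partialSum_succ]
    push_cast
    rcases hx n with h3 | h3 <;> rw [h3] <;> omega

lemma stoppedWeight_of_avoids {s t : ℝ} {d : ℤ} {x : ℕ → ℤ} {n : ℕ}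
    (h : ∀ k < n, partialSum x k ≠ d) : stoppedWeight s t d x n = weight s t x n := by
  induction n with
  | zero => simp [stoppedWeight, weight]
  | succ n ih =>
    have h1 : Avoids d x n := fun k hk => h k (by omega)
    rw [stoppedWeight, ih fun k hk => h k (by omega), avoidingWeight, if_pos h1]
    simp only [weight, Finset.prod_range_succ]
    ring

lemma stoppedWeight_of_hit {s t : ℝ} {d : ℤ} {x : ℕ → ℤ} {m n : ℕ} (hmn : m ≤ n)
    (h : ∀ k < m, partialSum x k ≠ d) (hm : partialSum x m = d) :
    stoppedWeight s t d x n = weight s t x m := by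
  induction n, hmn using Nat.le_induction with
  | base => exact stoppedWeight_of_avoids h
  | succ n hmn ih =>
    have h1 : ¬ Avoids d x n := fun h' => h' m hmn hm
    rw [stoppedWeight, ih, avoidingWeight, if_neg h1]
    ring

lemma weight_mem_Icc {s t : ℝ} (hs : s ∈ Set.Ioo (0 : ℝ) 1) (ht : t ∈ Set.Ioo (0 : ℝ) 1) {d : ℤ}
    {x : ℕ → ℤ} (hx : IsUnitPath x) {n : ℕ} (h : partialSum x n ≤ d) :
    weight s t x n ∈ Set.Icc 0 (s ^ n * t ^ (-d)) := by
  have h0 := hs.1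
  have h1 := ht.1
  rw [weight_eq h1.ne' hx]
  refine ⟨by positivity, ?_⟩
  gcongr ?_ * ?_
  exact zpow_le_zpow_right_of_le_one₀ h1 ht.2.le (by omega)

/-- Up to the first visit the path stays at or below `d`, and `t < 1`. The bound is uniform in `n`
and serves as the dominating constant. -/
lemma stoppedWeight_mem_Icc {s t : ℝ} (hs : s ∈ Set.Ioo (0 : ℝ) 1) (ht : t ∈ Set.Ioo (0 : ℝ) 1)
    {d : ℤ} (hd : 0 < d) {x : ℕ → ℤ} (hx : IsUnitPath x) (n : ℕ) :
    stoppedWeight s t d x n ∈ Set.Icc 0 (t ^ (-d)) := by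
  have key : ∀ m, partialSum x m ≤ d → weight s t x m ∈ Set.Icc 0 (t ^ (-d)) := fun m hm => by
    have h1 := weight_mem_Icc hs ht hx hm
    refine ⟨h1.1, h1.2.trans ?_⟩
    have h0 := ht.1
    exact mul_le_of_le_one_left (by positivity) (pow_le_one₀ hs.1.le hs.2.le)
  by_cases h : Avoids d x n
  · rw [stoppedWeight_of_avoids fun k hk => h k hk.le]
    exact key n (partialSum_lt hd hx h).le
  · have h' : ∃ k, k ≤ n ∧ partialSum x k = d := by simpa [Avoids] using h
    classical
    have hf := Nat.find_spec h'
    have hm : ∀ k < Nat.find h', partialSum x k ≠ d := fun k hk hk' =>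
      Nat.find_min h' hk ⟨by omega, hk'⟩
    rw [stoppedWeight_of_hit hf.1 hm hf.2]
    exact key _ hf.2.le

lemma tendsto_stoppedWeight_of_hit {s t : ℝ} (ht : 0 < t) {d : ℤ} {x : ℕ → ℤ}
    (hx : IsUnitPath x) {m : ℕ} (h : ∀ k < m, partialSum x k ≠ d) (hm : partialSum x m = d) :
    Tendsto (stoppedWeight s t d x) atTop (𝓝 (s ^ m * t ^ (-d))) := by
  refine tendsto_const_nhds.congr' ?_
  filter_upwards [eventually_ge_atTop m] with n hn
  rw [stoppedWeight_of_hit hn h hm, weight_eq ht.ne' hx, hm]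

/-- The position stays below `d`, so the factor `s ^ n` kills the weight; paths that never hit
contribute nothing in the limit. -/
lemma tendsto_stoppedWeight_of_avoids {s t : ℝ} (hs : s ∈ Set.Ioo (0 : ℝ) 1)
    (ht : t ∈ Set.Ioo (0 : ℝ) 1) {d : ℤ} (hd : 0 < d) {x : ℕ → ℤ} (hx : IsUnitPath x)
    (h : ∀ n, partialSum x n ≠ d) :
    Tendsto (stoppedWeight s t d x) atTop (𝓝 0) := by
  have hb : ∀ n, stoppedWeight s t d x n ∈ Set.Icc 0 (s ^ n * t ^ (-d)) := fun n => by
    rw [stoppedWeight_of_avoids fun k _ => h k]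
    exact weight_mem_Icc hs ht hx (partialSum_lt hd hx fun k _ => h k).le
  refine squeeze_zero (fun n => (hb n).1) (fun n => (hb n).2) ?_
  simpa using (tendsto_pow_atTop_nhds_zero_of_lt_one hs.1.le hs.2).mul_const (t ^ (-d))

end WalkWinRate

/-! ### Hitting times and the stopped exponential martingale. -/

namespace WalkWinRate

lemma hitTime_eq_top_iff {Ω : Type*} {S : ℕ → Ω → ℤ} {d : ℕ} {ω : Ω} :
    hitTime S d ω = ⊤ ↔ ∀ n, S n ω ≠ d := by
  simp [hitTime, hittingAfter_eq_top_iff]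

lemma hitTime_eq_coe_iff {Ω : Type*} {S : ℕ → Ω → ℤ} {d n : ℕ} {ω : Ω} :
    hitTime S d ω = n ↔ S n ω = d ∧ ∀ k < n, S k ω ≠ d := by
  have hle : ∀ m : ℕ, hitTime S d ω ≤ m ↔ ∃ k ≤ m, S k ω = d := fun m => by
    simpa [hitTime] using hittingAfter_le_iff (u := S) (s := {(d : ℤ)}) (n := 0) (i := m) (ω := ω)
  constructor
  · intro h
    have hlt : ∀ k < n, S k ω ≠ d := fun k hk hk' => by
      have h1 := (hle k).2 ⟨k, le_rfl, hk'⟩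
      rw [h] at h1
      exact absurd (WithTop.coe_le_coe.1 h1) (by simpa using hk)
    obtain ⟨k, hk, hk'⟩ := (hle n).1 h.le
    rcases hk.lt_or_eq with h1 | rfl
    · exact absurd hk' (hlt k h1)
    · exact ⟨hk', hlt⟩
  · rintro ⟨h1, h2⟩
    have h3 := (hle n).2 ⟨n, le_rfl, h1⟩
    obtain ⟨m, hm⟩ := WithTop.ne_top_iff_exists.1 (ne_top_of_le_ne_top WithTop.coe_ne_top h3)
    rw [← hm] at h3 ⊢
    obtain ⟨k, hk, hk'⟩ := (hle m).1 hm.symm.le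
    have h4 : n ≤ k := not_lt.1 fun h => h2 k h hk'
    have h5 : m ≤ n := WithTop.coe_le_coe.1 h3
    have : m = n := by omega
    rw [this]
    rfl

/-- Extension of a finite tuple of steps by zeros. -/
def extendSteps {n : ℕ} (v : Finset.range n → ℤ) (k : ℕ) : ℤ :=
  if h : k ∈ Finset.range n then v ⟨k, h⟩ else 0

/-- Factoring through a countable space of finite tuples yields both measurability and independence
from the next increment. -/
lemma avoidingWeight_eq_comp {Ω : Type*} (s t : ℝ) (d : ℤ) (n : ℕ) (S : ℕ → Ω → ℤ) :
    (fun ω => avoidingWeight s t d (fun k => increment S k ω) n) =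
      (fun v : Finset.range n → ℤ => avoidingWeight s t d (extendSteps v) n) ∘
        fun ω (k : Finset.range n) => increment S k ω := by
  funext ω
  refine avoidingWeight_congr s t d fun k hk => ?_
  simp [extendSteps, hk]

namespace IsSimpleRandomWalk

variable {Ω : Type*} [MeasurableSpace Ω] {μ : Measure Ω} {p : ℝ} {S : ℕ → Ω → ℤ}

lemma measurable_increment (hS : IsSimpleRandomWalk μ p S) (k : ℕ) :
    Measurable (increment S k) :=
  (hS.measurable (k + 1)).sub (hS.measurable k)

lemma measurable_hitTime (hS : IsSimpleRandomWalk μ p S) (d : ℕ) :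
    Measurable fun ω => (hitTime S d ω).untopD 0 := by
  have hm : ∀ n : ℕ, MeasurableSet {ω | hitTime S d ω = n} := fun n => by
    simp only [hitTime_eq_coe_iff, Set.ofPred_and, Set.ofPred_forall]
    exact (hS.measurable n (measurableSet_singleton _)).inter <|
      MeasurableSet.iInter fun k => MeasurableSet.iInter fun _ =>
        (hS.measurable k (measurableSet_singleton _)).compl
  have ht : MeasurableSet {ω | hitTime S d ω = ⊤} := by
    simp only [hitTime_eq_top_iff, Set.ofPred_forall]
    exact MeasurableSet.iInter fun k => (hS.measurable k (measurableSet_singleton _)).compl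
  refine measurable_to_countable' fun n => ?_
  -- The default value `0` merges the event `⊤` with the event that the hitting time is `0`.
  have : (fun ω => (hitTime S d ω).untopD 0) ⁻¹' {n} =
      {ω | hitTime S d ω = n} ∪ ({ω | hitTime S d ω = ⊤} ∩ {_ω | n = 0}) := by
    ext ω
    simp only [Set.mem_preimage, Set.mem_singleton_iff, Set.mem_union, Set.mem_inter_iff,
      Set.mem_ofPred_eq]
    cases hitTime S d ω with
    | top => simpa using eq_comm
    | coe m =>
      simp only [WithTop.untopD_coe, WithTop.coe_ne_top, false_and, or_false]
      exact WithTop.coe_inj.symm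
  rw [this]
  exact (hm n).union (ht.inter (MeasurableSet.const _))

lemma measurableSet_hitTime_eq_top (hS : IsSimpleRandomWalk μ p S) (d : ℕ) :
    MeasurableSet {ω | hitTime S d ω = ⊤} := by
  simp only [hitTime_eq_top_iff, Set.ofPred_forall]
  exact MeasurableSet.iInter fun k => (hS.measurable k (measurableSet_singleton _)).compl

lemma ae_eq_partialSum (hS : IsSimpleRandomWalk μ p S) :
    ∀ᵐ ω ∂μ, ∀ n, S n ω = partialSum (fun k => increment S k ω) n := by
  filter_upwards [hS.start] with ω h n
  induction n with
  | zero => simp [h, partialSum]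
  | succ n ih => rw [partialSum_succ, ← ih, increment]; ring

lemma measurable_avoidingWeight (hS : IsSimpleRandomWalk μ p S) (s t : ℝ) (d : ℤ) (n : ℕ) :
    Measurable fun ω => avoidingWeight s t d (fun k => increment S k ω) n := by
  rw [avoidingWeight_eq_comp]
  exact (measurable_of_countable _).comp
    (measurable_pi_lambda _ fun k => hS.measurable_increment k)

lemma indepFun_avoidingWeight (hS : IsSimpleRandomWalk μ p S) (s t : ℝ) (d : ℤ) (n : ℕ) :
    IndepFun (fun ω => avoidingWeight s t d (fun k => increment S k ω) n)
      (fun ω => stepWeight s t (increment S n ω) - 1) μ := by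
  rw [avoidingWeight_eq_comp]
  have h := hS.indep.indepFun_finset (Finset.range n) {n} (by simp) hS.measurable_increment
  exact h.comp (φ := fun v : Finset.range n → ℤ => avoidingWeight s t d (extendSteps v) n)
    (ψ := fun v : ({n} : Finset ℕ) → ℤ => stepWeight s t (v ⟨n, by simp⟩) - 1)
    (measurable_of_countable _) (measurable_of_countable _)

lemma measurable_stepWeight (hS : IsSimpleRandomWalk μ p S) (s t : ℝ) (k : ℕ) :
    Measurable fun ω => stepWeight s t (increment S k ω) :=
  (measurable_of_countable (stepWeight s t)).comp (hS.measurable_increment k)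

variable [IsProbabilityMeasure μ]

lemma ae_isUnitPath (hS : IsSimpleRandomWalk μ p S) :
    ∀ᵐ ω ∂μ, IsUnitPath fun k => increment S k ω := by
  refine ae_all_iff.2 fun k => ?_
  have hm1 : MeasurableSet {ω | increment S k ω = 1} :=
    hS.measurable_increment k (measurableSet_singleton _)
  have hm2 : MeasurableSet {ω | increment S k ω = -1} :=
    hS.measurable_increment k (measurableSet_singleton _)
  have hd : Disjoint {ω | increment S k ω = 1} {ω | increment S k ω = -1} := by
    refine Set.disjoint_left.2 fun ω h1 h2 => ?_
    simp only [Set.mem_ofPred_eq] at h1 h2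
    omega
  have h := measureReal_union (μ := μ) hd hm2
  rw [hS.prob_up, hS.prob_down] at h
  have h1 : μ ({ω | increment S k ω = 1} ∪ {ω | increment S k ω = -1}) = 1 := by
    rw [Measure.real] at h
    rw [← ENNReal.toReal_eq_one_iff, h]
    ring
  exact (prob_compl_eq_zero_iff (hm1.union hm2)).2 h1

lemma integral_stepWeight (hS : IsSimpleRandomWalk μ p S) (s t : ℝ) (k : ℕ) :
    ∫ ω, stepWeight s t (increment S k ω) ∂μ = s / t * p + s * t * (1 - p) := by
  have hm1 : MeasurableSet {ω | increment S k ω = 1} :=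
    hS.measurable_increment k (measurableSet_singleton _)
  have hm2 : MeasurableSet {ω | increment S k ω = -1} :=
    hS.measurable_increment k (measurableSet_singleton _)
  have h : ∀ ω, stepWeight s t (increment S k ω) =
      Set.indicator {ω | increment S k ω = 1} (fun _ => s / t) ω +
      Set.indicator {ω | increment S k ω = -1} (fun _ => s * t) ω := fun ω => by
    simp only [stepWeight, Set.indicator_apply, Set.mem_ofPred_eq]
    split_ifs with h1 h2
    · omega
    · simp
    · simp
    · simp
  simp_rw [h]
  rw [integral_add ((integrable_const _).indicator hm1) ((integrable_const _).indicator hm2),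
    integral_indicator_const _ hm1, integral_indicator_const _ hm2, hS.prob_up, hS.prob_down]
  simp only [smul_eq_mul]
  ring

lemma integrable_stepWeight (hS : IsSimpleRandomWalk μ p S) {s t : ℝ} (hs : 0 ≤ s) (ht : 0 < t)
    (k : ℕ) : Integrable (fun ω => stepWeight s t (increment S k ω)) μ :=
  Integrable.of_bound (hS.measurable_stepWeight s t k).aestronglyMeasurable _
    (ae_of_all _ fun _ => abs_stepWeight_le hs ht _)

lemma integrable_avoidingWeight (hS : IsSimpleRandomWalk μ p S) {s t : ℝ} (hs : 0 ≤ s)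
    (ht : 0 < t) (d : ℤ) (n : ℕ) :
    Integrable (fun ω => avoidingWeight s t d (fun k => increment S k ω) n) μ :=
  Integrable.of_bound (hS.measurable_avoidingWeight s t d n).aestronglyMeasurable _
    (ae_of_all _ fun _ => abs_avoidingWeight_le hs ht _ _ _)

/-- Each martingale increment is a function of the past times an independent factor, which `hst`
makes centred. -/
lemma integral_stoppedWeight (hS : IsSimpleRandomWalk μ p S) {s t : ℝ} (hs : 0 ≤ s) (ht : 0 < t)
    (hst : s / t * p + s * t * (1 - p) = 1) (d : ℤ) (n : ℕ) :
    Integrable (fun ω => stoppedWeight s t d (fun k => increment S k ω) n) μ ∧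
      ∫ ω, stoppedWeight s t d (fun k => increment S k ω) n ∂μ = 1 := by
  induction n with
  | zero => simp [stoppedWeight]
  | succ n ih =>
    have h1 := hS.integrable_avoidingWeight hs ht d n
    have h2 : Integrable (fun ω => stepWeight s t (increment S n ω) - 1) μ :=
      (hS.integrable_stepWeight hs ht n).sub (integrable_const 1)
    have h3 := hS.indepFun_avoidingWeight s t d n
    have h4 : ∫ ω, stepWeight s t (increment S n ω) - 1 ∂μ = 0 := by
      rw [integral_sub (hS.integrable_stepWeight hs ht n) (integrable_const 1),
        hS.integral_stepWeight, hst]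
      simp
    have h5 : Integrable (fun ω => avoidingWeight s t d (fun k => increment S k ω) n *
        (stepWeight s t (increment S n ω) - 1)) μ := h3.integrable_mul h1 h2
    simp only [stoppedWeight]
    refine ⟨ih.1.add h5, ?_⟩
    rw [integral_add ih.1 h5, ih.2, h3.integral_fun_mul_eq_mul_integral h1.aestronglyMeasurable
      h2.aestronglyMeasurable, h4]
    simp

/-- The generating function of the hitting time, restricted to the event that it is finite. -/
lemma integral_pow_hitTime (hS : IsSimpleRandomWalk μ p S) {s t : ℝ} (hs : s ∈ Set.Ioo (0 : ℝ) 1)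
    (ht : t ∈ Set.Ioo (0 : ℝ) 1) (hst : s / t * p + s * t * (1 - p) = 1) {d : ℕ} (hd : 1 ≤ d) :
    ∫ ω, {ω | hitTime S d ω ≠ ⊤}.indicator (fun ω => s ^ (hitTime S d ω).untopD 0) ω ∂μ
      = t ^ d := by
  have hd' : (0 : ℤ) < d := by exact_mod_cast hd
  have ht0 := ht.1
  have hlim : Tendsto
      (fun n => ∫ ω, stoppedWeight s t d (fun k => increment S k ω) n ∂μ) atTop
      (𝓝 (∫ ω, {ω | hitTime S d ω ≠ ⊤}.indicator
        (fun ω => s ^ (hitTime S d ω).untopD 0) ω * t ^ (-(d : ℤ)) ∂μ)) := by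
    refine tendsto_integral_of_dominated_convergence (fun _ => t ^ (-(d : ℤ)))
      (fun n => (hS.integral_stoppedWeight hs.1.le ht.1 hst d n).1.aestronglyMeasurable)
      (integrable_const _) (fun n => ?_) ?_
    · filter_upwards [hS.ae_isUnitPath] with ω hω
      have h := stoppedWeight_mem_Icc hs ht hd' hω n
      rw [Real.norm_of_nonneg h.1]
      exact h.2
    · filter_upwards [hS.ae_isUnitPath, hS.ae_eq_partialSum] with ω hω hω'
      cases h : hitTime S d ω with
      | top =>
        have h1 := hitTime_eq_top_iff.1 h
        simp only [hω'] at h1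
        rw [Set.indicator_of_notMem (by simpa using h), zero_mul]
        exact tendsto_stoppedWeight_of_avoids hs ht hd' hω h1
      | coe m =>
        have h1 := hitTime_eq_coe_iff.1 h
        simp only [hω'] at h1
        rw [Set.indicator_of_mem (by simp [h]), h]
        exact tendsto_stoppedWeight_of_hit ht.1 hω h1.2 h1.1
  -- All the integrals equal `1`, so the limit does too; dividing out `t ^ (-d)` gives the claim.
  simp only [(hS.integral_stoppedWeight hs.1.le ht.1 hst d _).2, integral_mul_const] at hlim
  have h := tendsto_nhds_unique hlim tendsto_const_nhds
  rw [zpow_neg, zpow_natCast, ← div_eq_mul_inv, div_eq_one_iff_eq (by positivity)] at h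
  exact h

end IsSimpleRandomWalk
end WalkWinRate

/-! ### Calculus of the inverse generating function. -/

namespace WalkWinRate

/-- The compositional inverse of the generating function of the first passage time to `1`. -/
noncomputable def invGen (p t : ℝ) : ℝ := t / (p + (1 - p) * t ^ 2)

/-- The logarithmic derivative of `invGen p`, multiplied by `t`. -/
noncomputable def ratio (p t : ℝ) : ℝ := (p - (1 - p) * t ^ 2) / (p + (1 - p) * t ^ 2)

lemma denom_pos {p : ℝ} (hp : p ∈ Set.Ico (1 / 2 : ℝ) 1) (t : ℝ) : 0 < p + (1 - p) * t ^ 2 := by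
  have h1 := hp.1
  have h2 : 0 ≤ (1 - p) * t ^ 2 := mul_nonneg (by linarith [hp.2]) (sq_nonneg t)
  linarith

lemma invGen_mem_Ioo {p t : ℝ} (hp : p ∈ Set.Ico (1 / 2 : ℝ) 1) (ht : t ∈ Set.Ioo (0 : ℝ) 1) :
    invGen p t ∈ Set.Ioo (0 : ℝ) 1 := by
  have h := denom_pos hp t
  refine ⟨div_pos ht.1 h, (div_lt_one h).2 ?_⟩
  -- The denominator minus `t` factors as `(1 - t) * (p - (1 - p) * t)`; this uses `p ≥ 1/2`.
  have h1 : 0 < p - (1 - p) * t := by nlinarith [hp.1, hp.2, ht.1, ht.2]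
  nlinarith [mul_pos (sub_pos.2 ht.2) h1]

lemma invGen_spec {p t : ℝ} (hp : p ∈ Set.Ico (1 / 2 : ℝ) 1) (ht : 0 < t) :
    invGen p t / t * p + invGen p t * t * (1 - p) = 1 := by
  have h := (denom_pos hp t).ne'
  have h1 : invGen p t / t * p + invGen p t * t * (1 - p) =
      (p + (1 - p) * t ^ 2) / (p + (1 - p) * t ^ 2) := by
    unfold invGen
    field_simp
  rw [h1, div_self h]

lemma hasDerivAt_denom (p t : ℝ) :
    HasDerivAt (fun t : ℝ => p + (1 - p) * t ^ 2) ((1 - p) * (2 * t)) t := by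
  have h := (((hasDerivAt_id t).pow 2).const_mul (1 - p)).const_add p
  simpa using h

lemma hasDerivAt_invGen {p : ℝ} (hp : p ∈ Set.Ico (1 / 2 : ℝ) 1) (t : ℝ) :
    HasDerivAt (invGen p) ((p - (1 - p) * t ^ 2) / (p + (1 - p) * t ^ 2) ^ 2) t := by
  have h := (hasDerivAt_id' t).fun_div (hasDerivAt_denom p t) (denom_pos hp t).ne'
  refine h.congr_deriv ?_
  ring

lemma hasDerivAt_ratio {p : ℝ} (hp : p ∈ Set.Ico (1 / 2 : ℝ) 1) (t : ℝ) :
    HasDerivAt (ratio p) (-(4 * p * (1 - p) * t) / (p + (1 - p) * t ^ 2) ^ 2) t := by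
  have h1 : HasDerivAt (fun t : ℝ => p - (1 - p) * t ^ 2) (-((1 - p) * (2 * t))) t := by
    have h := (((hasDerivAt_id t).pow 2).const_mul (1 - p)).const_sub p
    simpa using h
  have h := h1.fun_div (hasDerivAt_denom p t) (denom_pos hp t).ne'
  refine h.congr_deriv ?_
  ring

lemma continuous_invGen {p : ℝ} (hp : p ∈ Set.Ico (1 / 2 : ℝ) 1) : Continuous (invGen p) :=
  continuous_iff_continuousAt.2 fun t => (hasDerivAt_invGen hp t).continuousAt

lemma continuous_ratio {p : ℝ} (hp : p ∈ Set.Ico (1 / 2 : ℝ) 1) : Continuous (ratio p) :=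
  continuous_iff_continuousAt.2 fun t => (hasDerivAt_ratio hp t).continuousAt

lemma continuous_deriv_invGen {p : ℝ} (hp : p ∈ Set.Ico (1 / 2 : ℝ) 1) :
    Continuous fun t : ℝ => (p - (1 - p) * t ^ 2) / (p + (1 - p) * t ^ 2) ^ 2 :=
  Continuous.div (by fun_prop) (by fun_prop) fun t => (pow_pos (denom_pos hp t) 2).ne'

/-- The antiderivative `invGen ^ n / n` runs from `0` at `t = 0` to `1 / n` at `t = 1`. -/
lemma integral_invGen_pow_mul_deriv {p : ℝ} (hp : p ∈ Set.Ico (1 / 2 : ℝ) 1) {n : ℕ}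
    (hn : 1 ≤ n) :
    ∫ t in (0 : ℝ)..1, invGen p t ^ (n - 1) *
      ((p - (1 - p) * t ^ 2) / (p + (1 - p) * t ^ 2) ^ 2) = 1 / (n : ℝ) := by
  have hn0 : (n : ℝ) ≠ 0 := by exact_mod_cast (by omega : n ≠ 0)
  have h : ∀ t : ℝ, HasDerivAt (fun t => invGen p t ^ n / n) (invGen p t ^ (n - 1) *
      ((p - (1 - p) * t ^ 2) / (p + (1 - p) * t ^ 2) ^ 2)) t := fun t => by
    refine (((hasDerivAt_invGen hp t).fun_pow n).div_const (n : ℝ)).congr_deriv ?_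
    field_simp
  rw [intervalIntegral.integral_eq_sub_of_hasDerivAt (fun t _ => h t)
    ((((continuous_invGen hp).pow _).mul (continuous_deriv_invGen hp)).intervalIntegrable _ _)]
  have : n ≠ 0 := by omega
  simp [invGen, this]

/-- The integrals of `ratio p` against the probability densities `d * t ^ (d - 1)` on `[0, 1]`
strictly decrease in `d`. -/
lemma integral_mul_ratio_strictAnti {p : ℝ} (hp : p ∈ Set.Ico (1 / 2 : ℝ) 1) (d : ℕ) (hd : 1 ≤ d) :
    ∫ t in (0 : ℝ)..1, ((d + 1 : ℕ) : ℝ) * (t ^ d * ratio p t) <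
      ∫ t in (0 : ℝ)..1, (d : ℝ) * (t ^ (d - 1) * ratio p t) := by
  have hr := continuous_ratio hp
  have hr' : Continuous fun t : ℝ => -(4 * p * (1 - p) * t) / (p + (1 - p) * t ^ 2) ^ 2 :=
    Continuous.div (by fun_prop) (by fun_prop) fun t => (pow_pos (denom_pos hp t) 2).ne'
  -- The difference of the two distribution functions vanishes at both ends, so integration by parts
  -- has no boundary term and leaves a positive function times the negative derivative of `ratio p`.
  have hu : ∀ t : ℝ, HasDerivAt (fun t : ℝ => t ^ d - t ^ (d + 1))
      ((d : ℝ) * t ^ (d - 1) - ((d + 1 : ℕ) : ℝ) * t ^ d) t := fun t => by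
    simpa using (hasDerivAt_pow d t).fun_sub (hasDerivAt_pow (d + 1) t)
  have h := intervalIntegral.integral_deriv_mul_eq_sub (a := 0) (b := 1) (fun t _ => hu t)
    (fun t _ => hasDerivAt_ratio hp t)
    (Continuous.intervalIntegrable (by fun_prop) _ _) (hr'.intervalIntegrable _ _)
  have hd0 : d ≠ 0 := by omega
  simp only [one_pow, sub_self, zero_mul, ne_eq, hd0, not_false_eq_true, zero_pow,
    Nat.add_eq_zero_iff, one_ne_zero, and_false] at h
  have hpos : 0 < ∫ t in (0 : ℝ)..1, (t ^ d - t ^ (d + 1)) *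
      ((4 * p * (1 - p) * t) / (p + (1 - p) * t ^ 2) ^ 2) := by
    refine intervalIntegral.intervalIntegral_pos_of_pos_on
      (Continuous.intervalIntegrable ?_ _ _) (fun t ht => ?_) one_pos
    · exact Continuous.mul (by fun_prop) (Continuous.div (by fun_prop) (by fun_prop)
        fun t => (pow_pos (denom_pos hp t) 2).ne')
    · have h1 := denom_pos hp t
      have h2 : 0 < t ^ d - t ^ (d + 1) := by
        rw [pow_succ]
        nlinarith [pow_pos ht.1 d, ht.2]
      have h3 : 0 < p := by linarith [hp.1]
      have h4 : 0 < 1 - p := by linarith [hp.2]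
      have h5 := ht.1
      positivity
  rw [← sub_pos, ← intervalIntegral.integral_sub
    (Continuous.intervalIntegrable (by fun_prop) _ _)
    (Continuous.intervalIntegrable (by fun_prop) _ _)]
  have hsum := intervalIntegral.integral_add (μ := volume) (a := 0) (b := 1)
    (f := fun t : ℝ => ((d : ℝ) * t ^ (d - 1) - ((d + 1 : ℕ) : ℝ) * t ^ d) * ratio p t
      + (t ^ d - t ^ (d + 1)) * (-(4 * p * (1 - p) * t) / (p + (1 - p) * t ^ 2) ^ 2))
    (g := fun t : ℝ => (t ^ d - t ^ (d + 1)) *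
      ((4 * p * (1 - p) * t) / (p + (1 - p) * t ^ 2) ^ 2))
    (Continuous.intervalIntegrable (by fun_prop) _ _)
    (Continuous.intervalIntegrable (by
      have : Continuous fun t : ℝ => (4 * p * (1 - p) * t) / (p + (1 - p) * t ^ 2) ^ 2 :=
        Continuous.div (by fun_prop) (by fun_prop) fun t => (pow_pos (denom_pos hp t) 2).ne'
      fun_prop) _ _)
  rw [h, zero_add] at hsum
  rw [← hsum] at hpos
  convert hpos using 3 with t
  ring

/-! ### Finiteness of the hitting time and the mean of its reciprocal. -/

namespace IsSimpleRandomWalk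

variable {Ω : Type*} [MeasurableSpace Ω] {μ : Measure Ω} [IsProbabilityMeasure μ] {p : ℝ}
  {S : ℕ → Ω → ℤ}

/-- The generating function is at most the probability of hitting, so that probability is at least
`t ^ d` for all `t < 1`. -/
lemma ae_hitTime_ne_top (hS : IsSimpleRandomWalk μ p S) (hp : p ∈ Set.Ico (1 / 2 : ℝ) 1) {d : ℕ}
    (hd : 1 ≤ d) : ∀ᵐ ω ∂μ, hitTime S d ω ≠ ⊤ := by
  have hm : MeasurableSet {ω | hitTime S d ω ≠ ⊤} := (hS.measurableSet_hitTime_eq_top d).compl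
  have key : ∀ t ∈ Set.Ioo (0 : ℝ) 1, t ^ d ≤ μ.real {ω | hitTime S d ω ≠ ⊤} := fun t ht => by
    have hs := invGen_mem_Ioo hp ht
    rw [← hS.integral_pow_hitTime hs ht (invGen_spec hp ht.1) hd, ← integral_indicator_one hm]
    have h0 : ∀ n : ℕ, 0 ≤ invGen p t ^ n := fun n => pow_nonneg hs.1.le n
    refine integral_mono_of_nonneg (ae_of_all _ fun ω => ?_)
      ((integrable_const (1 : ℝ)).indicator hm) (ae_of_all _ fun ω => ?_)
    · exact Set.indicator_nonneg (fun _ _ => h0 _) _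
    · exact Set.indicator_le_indicator (pow_le_one₀ hs.1.le hs.2.le)
  have h1 : (1 : ℝ) ≤ μ.real {ω | hitTime S d ω ≠ ⊤} := by
    have hc : Tendsto (fun t : ℝ => t ^ d) (𝓝[<] 1) (𝓝 1) := by
      have h := (continuous_pow d).tendsto (1 : ℝ)
      rw [one_pow] at h
      exact h.mono_left nhdsWithin_le_nhds
    refine le_of_tendsto hc ?_
    filter_upwards [Ioo_mem_nhdsLT (zero_lt_one' ℝ)] with t ht using key t ht
  have h2 : μ {ω | hitTime S d ω ≠ ⊤} = 1 := by
    rw [← ENNReal.toReal_eq_one_iff]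
    exact le_antisymm measureReal_le_one h1
  exact (prob_compl_eq_zero_iff hm).2 h2

lemma ae_le_hitTime (hS : IsSimpleRandomWalk μ p S) (hp : p ∈ Set.Ico (1 / 2 : ℝ) 1) {d : ℕ}
    (hd : 1 ≤ d) : ∀ᵐ ω ∂μ, d ≤ (hitTime S d ω).untopD 0 := by
  filter_upwards [hS.ae_hitTime_ne_top hp hd, hS.ae_isUnitPath, hS.ae_eq_partialSum]
    with ω h h1 h2
  obtain ⟨m, hm⟩ := WithTop.ne_top_iff_exists.1 h
  rw [← hm, WithTop.untopD_coe]
  have h3 := (hitTime_eq_coe_iff.1 hm.symm).1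
  rw [h2] at h3
  have h4 := partialSum_le h1 m
  omega

lemma integral_inv_hitTime (hS : IsSimpleRandomWalk μ p S) (hp : p ∈ Set.Ico (1 / 2 : ℝ) 1)
    {d : ℕ} (hd : 1 ≤ d) :
    ∫ ω, 1 / (((hitTime S d ω).untopD 0 : ℕ) : ℝ) ∂μ =
      ∫ t in (0 : ℝ)..1, t ^ (d - 1) * ratio p t := by
  set N : Ω → ℕ := fun ω => (hitTime S d ω).untopD 0 with hN
  have hNm : Measurable N := hS.measurable_hitTime d
  set D : ℝ → ℝ := fun t => (p - (1 - p) * t ^ 2) / (p + (1 - p) * t ^ 2) ^ 2 with hD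
  have hDc : Continuous D := continuous_deriv_invGen hp
  have hgc := continuous_invGen hp
  have hint : Integrable (Function.uncurry fun (t : ℝ) (ω : Ω) => invGen p t ^ (N ω - 1) * D t)
      ((volume.restrict (Set.uIoc 0 1)).prod μ) := by
    have : IsFiniteMeasure (volume.restrict (Set.uIoc (0 : ℝ) 1)) :=
      ⟨by simp [Set.uIoc_of_le]⟩
    obtain ⟨C, hC⟩ := isCompact_Icc.exists_bound_of_continuousOn (hDc.continuousOn (s := Set.Icc 0 1))
    have hmeas : Measurable (Function.uncurry fun (t : ℝ) (ω : Ω) => invGen p t ^ (N ω - 1) * D t) := by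
      refine Measurable.mul ?_ (hDc.measurable.comp measurable_fst)
      exact (hgc.measurable.comp measurable_fst).pow
        ((measurable_of_countable fun n : ℕ => n - 1).comp (hNm.comp measurable_snd))
    refine Integrable.of_bound hmeas.aestronglyMeasurable C ?_
    have h1 : ∀ᵐ z : ℝ × Ω ∂((volume.restrict (Set.uIoc 0 1)).prod μ), z.1 ∈ Set.uIoc (0 : ℝ) 1 :=
      Measure.quasiMeasurePreserving_fst.ae (ae_restrict_mem measurableSet_uIoc)
    filter_upwards [h1] with z hz
    rw [Set.uIoc_of_le zero_le_one] at hz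
    have h2 : ‖invGen p z.1‖ ≤ 1 := by
      rcases hz.2.lt_or_eq with h | h
      · have h3 := invGen_mem_Ioo hp ⟨hz.1, h⟩
        rw [Real.norm_of_nonneg h3.1.le]
        exact h3.2.le
      · simp [h, invGen]
    simp only [Function.uncurry, norm_mul, norm_pow]
    calc _ ≤ 1 * ‖D z.1‖ := by gcongr; exact pow_le_one₀ (norm_nonneg _) h2
      _ ≤ C := by rw [one_mul]; exact hC _ ⟨hz.1.le, hz.2⟩
  calc ∫ ω, 1 / (N ω : ℝ) ∂μ
      = ∫ ω, (∫ t in (0 : ℝ)..1, invGen p t ^ (N ω - 1) * D t) ∂μ := by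
        refine integral_congr_ae ?_
        filter_upwards [hS.ae_le_hitTime hp hd] with ω hω
        exact (integral_invGen_pow_mul_deriv hp (hd.trans hω)).symm
    _ = ∫ t in (0 : ℝ)..1, (∫ ω, invGen p t ^ (N ω - 1) * D t ∂μ) :=
        (intervalIntegral_integral_swap hint).symm
    _ = ∫ t in (0 : ℝ)..1, t ^ (d - 1) * ratio p t := by
        -- The endpoint `t = 1` is discarded because the generating function identity needs `t < 1`.
        rw [intervalIntegral.integral_of_le zero_le_one, intervalIntegral.integral_of_le zero_le_one,
          integral_Ioc_eq_integral_Ioo, integral_Ioc_eq_integral_Ioo]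
        refine setIntegral_congr_fun measurableSet_Ioo fun t ht => ?_
        have hs := invGen_mem_Ioo hp ht
        have hden := (denom_pos hp t).ne'
        have ht0 := ht.1.ne'
        have h1 : ∫ ω, invGen p t ^ (N ω - 1) ∂μ = t ^ d / invGen p t := by
          rw [← hS.integral_pow_hitTime hs ht (invGen_spec hp ht.1) hd, ← integral_div]
          refine integral_congr_ae ?_
          filter_upwards [hS.ae_le_hitTime hp hd, hS.ae_hitTime_ne_top hp hd] with ω h1 h2
          rw [Set.indicator_of_mem (by exact h2), eq_div_iff hs.1.ne', ← pow_succ,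
            Nat.sub_add_cancel (hd.trans h1)]
        simp only [integral_mul_const]
        rw [h1, ratio, hD]
        obtain ⟨e, rfl⟩ := Nat.exists_eq_add_of_le' hd
        simp only [Nat.add_sub_cancel, pow_succ t e, invGen]
        field_simp

end IsSimpleRandomWalk
end WalkWinRate

/-! ### The win rate: mean, strong law and limits. -/

namespace WalkWinRate

lemma wins_le {Ω : Type*} (S : ℕ → Ω → ℤ) (n : ℕ) (ω : Ω) : wins S n ω ≤ n :=
  (Finset.card_filter_le _ _).trans (by simp)

lemma winRate_mem_Icc {Ω : Type*} (S : ℕ → Ω → ℤ) (d : ℕ) (ω : Ω) :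
    winRate S d ω ∈ Set.Icc (0 : ℝ) 1 :=
  ⟨by unfold winRate; positivity,
    div_le_one_of_le₀ (by exact_mod_cast wins_le S _ ω) (by positivity)⟩

lemma two_mul_wins {Ω : Type*} {S : ℕ → Ω → ℤ} {ω : Ω}
    (h : IsUnitPath fun k => increment S k ω) (n : ℕ) :
    2 * (wins S n ω : ℤ) = n + partialSum (fun k => increment S k ω) n := by
  induction n with
  | zero => simp [wins, partialSum]
  | succ n ih =>
    have hw : wins S (n + 1) ω = wins S n ω + if increment S n ω = 1 then 1 else 0 := by
      simp only [wins, Finset.card_filter, Finset.sum_range_succ]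
    rw [partialSum_succ, hw]
    push_cast
    rcases h n with h1 | h1 <;> simp only [h1] <;> norm_num <;> linarith

namespace IsSimpleRandomWalk

variable {Ω : Type*} [MeasurableSpace Ω] {μ : Measure Ω} [IsProbabilityMeasure μ] {p : ℝ}
  {S : ℕ → Ω → ℤ}

/-- At the hitting time the position is `d`, so `two_mul_wins` reads `2 * R = N + d`. -/
lemma winRate_ae_eq (hS : IsSimpleRandomWalk μ p S) (hp : p ∈ Set.Ico (1 / 2 : ℝ) 1) {d : ℕ}
    (hd : 1 ≤ d) :
    winRate S d =ᵐ[μ] fun ω => 1 / 2 + d / 2 * (1 / (((hitTime S d ω).untopD 0 : ℕ) : ℝ)) := by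
  filter_upwards [hS.ae_hitTime_ne_top hp hd, hS.ae_isUnitPath, hS.ae_eq_partialSum,
    hS.ae_le_hitTime hp hd] with ω h h1 h2 h3
  obtain ⟨m, hm⟩ := WithTop.ne_top_iff_exists.1 h
  rw [winRate]
  rw [← hm, WithTop.untopD_coe] at h3 ⊢
  have h4 := (hitTime_eq_coe_iff.1 hm.symm).1
  rw [h2] at h4
  have h5 := two_mul_wins h1 m
  rw [h4] at h5
  have h6 : 2 * (wins S m ω : ℝ) = m + d := by exact_mod_cast h5
  have h7 : (m : ℝ) ≠ 0 := by exact_mod_cast (by omega : m ≠ 0)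
  field_simp
  linarith

lemma aestronglyMeasurable_winRate (hS : IsSimpleRandomWalk μ p S)
    (hp : p ∈ Set.Ico (1 / 2 : ℝ) 1) {d : ℕ} (hd : 1 ≤ d) :
    AEStronglyMeasurable (winRate S d) μ := by
  have h : Measurable fun ω => 1 / 2 + (d : ℝ) / 2 * (1 / (((hitTime S d ω).untopD 0 : ℕ) : ℝ)) :=
    (measurable_of_countable fun n : ℕ => 1 / 2 + (d : ℝ) / 2 * (1 / (n : ℝ))).comp
      (hS.measurable_hitTime d)
  exact h.aestronglyMeasurable.congr (hS.winRate_ae_eq hp hd).symm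

lemma memLp_winRate (hS : IsSimpleRandomWalk μ p S) (hp : p ∈ Set.Ico (1 / 2 : ℝ) 1) {d : ℕ}
    (hd : 1 ≤ d) : MemLp (winRate S d) 2 μ :=
  MemLp.of_bound (hS.aestronglyMeasurable_winRate hp hd) 1 <| ae_of_all _ fun ω => by
    rw [Real.norm_of_nonneg (winRate_mem_Icc S d ω).1]
    exact (winRate_mem_Icc S d ω).2

lemma integral_winRate (hS : IsSimpleRandomWalk μ p S) (hp : p ∈ Set.Ico (1 / 2 : ℝ) 1) {d : ℕ}
    (hd : 1 ≤ d) :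
    ∫ ω, winRate S d ω ∂μ =
      1 / 2 + (∫ t in (0 : ℝ)..1, (d : ℝ) * (t ^ (d - 1) * ratio p t)) / 2 := by
  have hi : Integrable (fun ω => 1 / (((hitTime S d ω).untopD 0 : ℕ) : ℝ)) μ := by
    refine Integrable.of_bound ((measurable_of_countable fun n : ℕ => 1 / (n : ℝ)).comp
      (hS.measurable_hitTime d)).aestronglyMeasurable 1 (ae_of_all _ fun ω => ?_)
    rw [Real.norm_of_nonneg (by positivity), one_div]
    exact Nat.cast_inv_le_one _
  rw [integral_congr_ae (hS.winRate_ae_eq hp hd), integral_add (integrable_const _)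
    (hi.const_mul _), integral_const_mul, hS.integral_inv_hitTime hp hd,
    intervalIntegral.integral_const_mul]
  simp
  ring

/-- The strong law of large numbers for the number of wins. -/
lemma ae_tendsto_wins_div (hS : IsSimpleRandomWalk μ p S) :
    ∀ᵐ ω ∂μ, Tendsto (fun n : ℕ => (wins S n ω : ℝ) / n) atTop (𝓝 p) := by
  set f : ℤ → ℝ := fun x => if x = 1 then 1 else 0 with hf
  have hfm : Measurable f := measurable_of_countable f
  have hm : ∀ k, MeasurableSet {ω | increment S k ω = 1} := fun k =>
    hS.measurable_increment k (measurableSet_singleton _)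
  have hid : ∀ k, IdentDistrib (increment S k) (increment S 0) μ μ := fun k => by
    refine ⟨(hS.measurable_increment k).aemeasurable, (hS.measurable_increment 0).aemeasurable, ?_⟩
    -- The increments have no mass outside `1` and `-1`, where the masses are prescribed.
    refine Measure.ext_of_singleton fun x => ?_
    rw [Measure.map_apply (hS.measurable_increment k) (measurableSet_singleton _),
      Measure.map_apply (hS.measurable_increment 0) (measurableSet_singleton _)]
    by_cases h1 : x = 1
    · subst h1
      exact (measureReal_eq_measureReal_iff).1 ((hS.prob_up k).trans (hS.prob_up 0).symm)
    by_cases h2 : x = -1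
    · subst h2
      exact (measureReal_eq_measureReal_iff).1 ((hS.prob_down k).trans (hS.prob_down 0).symm)
    · have h3 : ∀ j, μ (increment S j ⁻¹' {x}) = 0 := fun j => by
        refine measure_eq_zero_iff_ae_notMem.2 ?_
        filter_upwards [hS.ae_isUnitPath] with ω hω hx
        have hx' : increment S j ω = x := hx
        rcases hω j with h | h
        · exact h1 (hx'.symm.trans h)
        · exact h2 (hx'.symm.trans h)
      rw [h3, h3]
  have hint : Integrable (fun ω => f (increment S 0 ω)) μ := by
    refine Integrable.of_bound (hfm.comp (hS.measurable_increment 0)).aestronglyMeasurable 1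
      (ae_of_all _ fun ω => ?_)
    simp only [hf]
    split_ifs <;> simp
  have hmean : ∫ ω, f (increment S 0 ω) ∂μ = p := by
    rw [← hS.prob_up 0, ← integral_indicator_one (hm 0)]
    refine integral_congr_ae (ae_of_all _ fun ω => ?_)
    simp [hf, Set.indicator_apply]
  have h := strong_law_ae_real (fun k ω => f (increment S k ω)) hint
    (fun i j hij => (hS.indep.indepFun hij).comp hfm hfm) (fun k => (hid k).comp hfm)
  rw [hmean] at h
  filter_upwards [h] with ω hω
  convert hω using 3 with n
  simp [wins, hf]

/-- Unit steps force `N_d ≥ d`, so `N_d → ∞` and the strong law applies along these random times. -/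
lemma ae_tendsto_winRate (hS : IsSimpleRandomWalk μ p S) (hp : p ∈ Set.Ico (1 / 2 : ℝ) 1) :
    ∀ᵐ ω ∂μ, Tendsto (fun d => winRate S d ω) atTop (𝓝 p) := by
  have h : ∀ᵐ ω ∂μ, ∀ d, 1 ≤ d → d ≤ (hitTime S d ω).untopD 0 :=
    ae_all_iff.2 fun d => by
      by_cases hd : 1 ≤ d
      · filter_upwards [hS.ae_le_hitTime hp hd] with ω h _ using h
      · exact ae_of_all _ fun ω h => absurd h hd
  filter_upwards [h, hS.ae_tendsto_wins_div] with ω h1 h2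
  refine h2.comp (tendsto_atTop_mono' atTop ?_ tendsto_id)
  filter_upwards [eventually_ge_atTop 1] with d hd using h1 d hd

/-- Win rates lie in `[0,1]`, so bounded convergence applies; `k = 1` gives the mean, and with `k =
2` the variance. -/
lemma tendsto_integral_winRate_pow (hS : IsSimpleRandomWalk μ p S)
    (hp : p ∈ Set.Ico (1 / 2 : ℝ) 1) (k : ℕ) :
    Tendsto (fun d : ℕ => ∫ ω, winRate S d ω ^ k ∂μ) atTop (𝓝 (p ^ k)) := by
  have h : Tendsto (fun d : ℕ => ∫ ω, winRate S d ω ^ k ∂μ) atTop (𝓝 (∫ _, p ^ k ∂μ)) := by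
    refine tendsto_integral_filter_of_dominated_convergence (fun _ => 1) ?_ ?_
      (integrable_const _) ?_
    · filter_upwards [eventually_ge_atTop 1] with d hd
      exact (hS.aestronglyMeasurable_winRate hp hd).pow k
    · refine Eventually.of_forall fun d => ae_of_all _ fun ω => ?_
      have h := winRate_mem_Icc S d ω
      rw [norm_pow, Real.norm_of_nonneg h.1]
      exact pow_le_one₀ h.1 h.2
    · filter_upwards [hS.ae_tendsto_winRate hp] with ω hω using hω.pow k
  simpa using h

end IsSimpleRandomWalk
end WalkWinRate

theorem corollary1 {Ω : Type*} [MeasurableSpace Ω] (μ : Measure Ω) [IsProbabilityMeasure μ]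
    (p : ℝ) (hp : p ∈ Set.Ico (1 / 2 : ℝ) 1) (S : ℕ → Ω → ℤ)
    (hS : WalkWinRate.IsSimpleRandomWalk μ p S) :
    (∀ d : ℕ, 1 ≤ d →
      (∀ᵐ ω ∂μ, WalkWinRate.hitTime S d ω ≠ ⊤) ∧ MemLp (WalkWinRate.winRate S d) 2 μ) ∧
    (∀ d : ℕ, 1 ≤ d →
      ∫ ω, WalkWinRate.winRate S (d + 1) ω ∂μ < ∫ ω, WalkWinRate.winRate S d ω ∂μ) ∧
    Tendsto (fun d : ℕ => ∫ ω, WalkWinRate.winRate S d ω ∂μ) atTop (𝓝 p) ∧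
    Tendsto (fun d : ℕ => variance (WalkWinRate.winRate S d) μ) atTop (𝓝 0) := by
  have hlim := hS.tendsto_integral_winRate_pow hp 1
  simp only [pow_one] at hlim
  refine ⟨fun d hd => ⟨hS.ae_hitTime_ne_top hp hd, hS.memLp_winRate hp hd⟩, fun d hd => ?_,
    hlim, ?_⟩
  · rw [hS.integral_winRate hp hd, hS.integral_winRate hp (Nat.le_add_left 1 d)]
    have h := WalkWinRate.integral_mul_ratio_strictAnti hp d hd
    rw [Nat.add_sub_cancel]
    linarith
  · have h := (hS.tendsto_integral_winRate_pow hp 2).sub (hlim.pow 2)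
    rw [sub_self] at h
    refine h.congr' ?_
    filter_upwards [eventually_ge_atTop 1] with d hd
    rw [variance_eq_sub (hS.memLp_winRate hp hd)]
    rfl
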